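/- Let $K$ be an infinite field of characteristic different from $2$ and $3$. Let $(A,\omega)$ be a Bernstein algebra over $K$, that is, a commutative, not necessarily associative or finite-dimensional, $K$-algebra $A$ with a nonzero algebra homomorphism $\omega:A\to K$ such that $(x^2)^2=\omega(x)^2x^2$ for all $x\in A$. Assume that $A$ is Noetherian or Artinian, that is, that $A$ satisfies the ascending or the descending chain condition on ideals. Let $e\in A$ be a nonzero idempotent, with Peirce decomposition $A=Ke\oplus U\oplus V$, where $$U=\{u\in A : eu=\tfrac12 u\},\qquad V=\{v\in A : ev=0\},$$ and let $N=\ker(\omega)=U\oplus V$ and $\mathrm{ann}_U(U)=\{u\in U : uU=0\}$. For subspaces $P,Q$ of $A$, let $PQ$ denote the subspace spanned by all products $pq$ with $p\in P$, $q\in Q$. Then for every subspace $I$ of $A$: (i) if $NI=I$, then $I\subseteq \mathrm{ann}_U(U)$ and $I$ is an ideal of $A$; (ii) $NI=I$ if and only if $VI=I$. -/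

import Mathlib

/-! Commutative, not necessarily associative or unital, algebras `A` over a field `K` are given by
`[NonUnitalNonAssocCommRing A] [Module K A] [SMulCommClass K A A] [IsScalarTower K A A]`;
the last two classes say that the multiplication is `K`-bilinear. -/

namespace BernsteinAlg

variable {K A : Type*} [Field K] [NonUnitalNonAssocCommRing A] [Module K A]

/-- The subspace `I` is an ideal of the algebra `A`. As `A` is commutative, absorption on one side
is enough. -/
def IsIdeal (I : Submodule K A) : Prop :=
  ∀ a : A, ∀ x ∈ I, a * x ∈ I

variable (K A) in
/-- `A` is Noetherian: every ascending sequence of ideals of `A` is stationary. -/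
def IsNoetherianAlg : Prop :=
  ∀ J : ℕ → Submodule K A, (∀ n, IsIdeal (J n)) → Monotone J → ∃ n, ∀ m, n ≤ m → J m = J n

variable (K A) in
/-- `A` is Artinian: every descending sequence of ideals of `A` is stationary. -/
def IsArtinianAlg : Prop :=
  ∀ J : ℕ → Submodule K A, (∀ n, IsIdeal (J n)) → Antitone J → ∃ n, ∀ m, n ≤ m → J m = J n

/-- `(A, ω)` is a Bernstein algebra: `ω : A → K` is a nonzero homomorphism of algebras and
`(x²)² = ω(x)² x²` for every `x`. -/
def IsBernstein (ω : A →ₙₐ[K] K) : Prop :=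
  (∃ x : A, ω x ≠ 0) ∧ ∀ x : A, (x * x) * (x * x) = (ω x) ^ 2 • (x * x)

/-- The barideal `N = ker ω`. -/
def barideal (ω : A →ₙₐ[K] K) : Submodule K A where
  carrier := {x | ω x = 0}
  add_mem' := by
    intro a b ha hb
    simp only [Set.mem_ofPred_eq] at *
    rw [map_add, ha, hb, add_zero]
  zero_mem' := map_zero ω
  smul_mem' := by
    intro c x hx
    simp only [Set.mem_ofPred_eq] at *
    rw [map_smul, hx, smul_zero]

variable [SMulCommClass K A A]

variable (K) in
/-- The Peirce component `U = {u ∈ A | e u = (1/2) u}`. -/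
def peirceU (e : A) : Submodule K A where
  carrier := {u | e * u = (2 : K)⁻¹ • u}
  add_mem' := by
    intro a b ha hb
    simp only [Set.mem_ofPred_eq] at *
    rw [mul_add, ha, hb, smul_add]
  zero_mem' := by simp
  smul_mem' := by
    intro c x hx
    simp only [Set.mem_ofPred_eq] at *
    rw [mul_smul_comm, hx, smul_comm]

variable (K) in
/-- The Peirce component `V = {v ∈ A | e v = 0}`. -/
def peirceV (e : A) : Submodule K A where
  carrier := {v | e * v = 0}
  add_mem' := by
    intro a b ha hb
    simp only [Set.mem_ofPred_eq] at *
    rw [mul_add, ha, hb, add_zero]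
  zero_mem' := mul_zero e
  smul_mem' := by
    intro c x hx
    simp only [Set.mem_ofPred_eq] at *
    rw [mul_smul_comm, hx, smul_zero]

variable [IsScalarTower K A A]

variable (K) in
/-- `ann_U(U) = {u ∈ U | u U = 0}`. -/
def annU (e : A) : Submodule K A where
  carrier := {u | u ∈ peirceU K e ∧ ∀ w ∈ peirceU K e, u * w = 0}
  add_mem' := by
    rintro a b ⟨ha, ha'⟩ ⟨hb, hb'⟩
    exact ⟨add_mem ha hb, fun w hw => by rw [add_mul, ha' w hw, hb' w hw, add_zero]⟩
  zero_mem' := ⟨zero_mem _, fun w _ => zero_mul w⟩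
  smul_mem' := by
    rintro c x ⟨hx, hx'⟩
    exact ⟨Submodule.smul_mem _ c hx, fun w hw => by rw [smul_mul_assoc, hx' w hw, smul_zero]⟩

/-- The product `P Q` of two subspaces: the subspace spanned by all `p * q`, `p ∈ P`, `q ∈ Q`. -/
def mulSub (P Q : Submodule K A) : Submodule K A :=
  Submodule.map₂ (LinearMap.mul K A) P Q

end BernsteinAlg

/-! Write `L` for `ann_U(U)`. The linearized Bernstein identity gives `N = U ⊕ V` with `UU ⊆ V`, `UV
⊆ U`, `VV ⊆ L`. Multiplications by elements of `V` are skew for the product `U × U → V`, so modulo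
`L` they anticommute on `U` (`anticomm`), and `N` satisfies the linearization of `x² x = 0` modulo
`L` (`cubic`).

The chain condition makes `N` finite-dimensional modulo `N²`. If `I ⊆ N I`, then `I` lies in the
largest `M ⊆ N` with `M = N M + L`, which is a graded ideal of `N`. By `cubic`, each generator of
`N` modulo `N²` acts on `M` with square zero modulo the rest, so generators can be dropped one at a
time until `M = N² M + L`. Then `M ∩ U` lies both in `(UU)U + L` and in `V(M ∩ U) + L`. Since
`V(V(V(V((UU)U)))) ⊆ L` (`quadruple_mul_mem_annU`), this forces `M ⊆ L`.

So `I ⊆ L`. There `U` acts as zero and `e` as `1/2`, hence `N I = V I` and `I` is an ideal. -/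

namespace BernsteinAlg

/-! ### Linearization of the Bernstein identity -/

section Polarization

variable {K A : Type*} [Field K] [NonUnitalNonAssocCommRing A] [Module K A]
  [SMulCommClass K A A] [IsScalarTower K A A] {ω : A →ₙₐ[K] K}

theorem IsBernstein.quadratic (h2 : (2 : K) ≠ 0) (hA : IsBernstein ω) (x y : A) :
    (2 : K) • ((x * x) * (y * y)) + (4 : K) • ((x * y) * (x * y)) =
      (ω x) ^ 2 • (y * y) + (ω y) ^ 2 • (x * x) + (4 * ω x * ω y) • (x * y) := by
  have hp := hA.2 (x + y)
  have hm := hA.2 (x - y)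
  have hx := hA.2 x
  have hy := hA.2 y
  have e1 : (x + y) * (x + y) = x * x + (2 : K) • (x * y) + y * y := by
    rw [mul_add, add_mul, add_mul, mul_comm y x]; module
  have e2 : (x - y) * (x - y) = x * x - (2 : K) • (x * y) + y * y := by
    rw [mul_sub, sub_mul, sub_mul, mul_comm y x]; module
  rw [e1] at hp
  rw [e2] at hm
  simp only [mul_add, add_mul, mul_sub, sub_mul, smul_mul_assoc, mul_smul_comm, map_add, map_sub,
    mul_comm (x * y) (x * x), mul_comm (y * y) (x * x), mul_comm (y * y) (x * y)] at hp hm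
  -- Adding the identities at `x + y` and `x - y` cancels the terms of odd degree in `y`.
  have : (2 : K) • ((2 : K) • ((x * x) * (y * y)) + (4 : K) • ((x * y) * (x * y))) =
      (2 : K) • ((ω x) ^ 2 • (y * y) + (ω y) ^ 2 • (x * x) + (4 * ω x * ω y) • (x * y)) := by
    linear_combination (norm := module) hp + hm - (2 : K) • hx - (2 : K) • hy
  exact smul_right_injective A h2 this

theorem IsBernstein.trilinear (h2 : (2 : K) ≠ 0) (hA : IsBernstein ω) (x z y : A) :
    (2 : K) • ((x * z) * (y * y)) + (4 : K) • ((x * y) * (z * y)) =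
      (ω x * ω z) • (y * y) + (ω y) ^ 2 • (x * z) + (2 * ω x * ω y) • (z * y) +
        (2 * ω z * ω y) • (x * y) := by
  have h := hA.quadratic h2 (x + z) y
  have hx := hA.quadratic h2 x y
  have hz := hA.quadratic h2 z y
  simp only [mul_add, add_mul, map_add, mul_comm z x, mul_comm (z * y) (x * y)] at h
  refine smul_right_injective A h2 ?_
  dsimp only
  linear_combination (norm := module) h - hx - hz

/-- The complete linearization of the identity `(x²)² = ω(x)² x²`. -/
theorem IsBernstein.multilinear (h2 : (2 : K) ≠ 0) (hA : IsBernstein ω) (a b c d : A) :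
    (2 : K) • ((a * b) * (c * d) + (a * c) * (b * d) + (a * d) * (b * c)) =
      (ω a * ω b) • (c * d) + (ω c * ω d) • (a * b) + (ω a * ω c) • (b * d) +
        (ω b * ω d) • (a * c) + (ω a * ω d) • (b * c) + (ω b * ω c) • (a * d) := by
  have h := hA.trilinear h2 a b (c + d)
  have hc := hA.trilinear h2 a b c
  have hd := hA.trilinear h2 a b d
  simp only [mul_add, add_mul, map_add, mul_comm d c] at h
  rw [mul_comm (a * d) (b * c)] at h
  rw [mul_comm (a * d) (b * c)]
  refine smul_right_injective A h2 ?_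
  dsimp only
  linear_combination (norm := module) h - hc - hd

end Polarization

/-! ### Peirce decomposition and its relations -/

section Peirce

variable {K A : Type*} [Field K] [NonUnitalNonAssocCommRing A] [Module K A]
  {ω : A →ₙₐ[K] K} {e : A}

theorem mem_barideal {x : A} : x ∈ barideal ω ↔ ω x = 0 := Iff.rfl

theorem IsBernstein.map_idempotent (hA : IsBernstein ω) (he : e * e = e) (he0 : e ≠ 0) :
    ω e = 1 := by
  have h : ω e * ω e = ω e := by rw [← map_mul, he]
  rcases eq_or_ne (ω e) 0 with h0 | h1
  · have h' := hA.2 e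
    rw [he, he, h0] at h'
    exact absurd (by simpa using h') he0
  · exact (mul_eq_left₀ h1).mp h

variable [SMulCommClass K A A]

theorem mem_peirceU {x : A} : x ∈ peirceU K e ↔ e * x = (2 : K)⁻¹ • x := Iff.rfl

theorem mem_peirceV {x : A} : x ∈ peirceV K e ↔ e * x = 0 := Iff.rfl

theorem peirceU_le_barideal (h2 : (2 : K) ≠ 0) (hω : ω e = 1) :
    peirceU K e ≤ barideal ω := by
  intro u hu
  have h := congrArg ω (mem_peirceU.mp hu)
  rw [map_mul, map_smul, hω, one_mul, smul_eq_mul] at h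
  rw [mem_barideal]
  have : (2 : K) * ω u = ω u := by nth_rw 1 [h]; rw [mul_inv_cancel_left₀ h2]
  linear_combination this

theorem peirceV_le_barideal (hω : ω e = 1) : peirceV K e ≤ barideal ω := by
  intro v hv
  have h := congrArg ω (mem_peirceV.mp hv)
  rwa [map_mul, map_zero, hω, one_mul] at h

variable [IsScalarTower K A A]

theorem IsBernstein.mul_mul_of_mem_barideal (h2 : (2 : K) ≠ 0) (h3 : (3 : K) ≠ 0)
    (hA : IsBernstein ω) (he : e * e = e) (hω : ω e = 1) {n : A} (hn : n ∈ barideal ω) :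
    (2 : K) • (e * (e * n)) = e * n := by
  have h := hA.multilinear h2 e e e n
  rw [he, hω, mem_barideal.mp hn] at h
  refine smul_right_injective A h3 ?_
  dsimp only
  rw [mul_comm (e * n) e] at h
  linear_combination (norm := module) h

/-- On `N`, multiplication by `2e` is idempotent; its image is `U` and its kernel is `V`. -/
theorem IsBernstein.barideal_eq (h2 : (2 : K) ≠ 0) (h3 : (3 : K) ≠ 0)
    (hA : IsBernstein ω) (he : e * e = e) (hω : ω e = 1) :
    barideal ω = peirceU K e ⊔ peirceV K e := by
  refine le_antisymm (fun n hn => ?_)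
    (sup_le (peirceU_le_barideal h2 hω) (peirceV_le_barideal hω))
  have h := hA.mul_mul_of_mem_barideal h2 h3 he hω hn
  refine Submodule.mem_sup.mpr ⟨(2 : K) • (e * n), ?_, n - (2 : K) • (e * n), ?_, by abel⟩
  · rw [mem_peirceU, mul_smul_comm, h, smul_smul, inv_mul_cancel₀ h2, one_smul]
  · rw [mem_peirceV, mul_sub, mul_smul_comm, h, sub_self]

/-- Relations between the Peirce components of a Bernstein algebra. -/
structure PeirceRelations (K : Type*) {A : Type*} [Field K] [NonUnitalNonAssocCommRing A]
    [Module K A] [SMulCommClass K A A] (e : A) : Prop where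
  disjoint : Disjoint (peirceU K e) (peirceV K e)
  mul_mem_UU : ∀ u ∈ peirceU K e, ∀ w ∈ peirceU K e, u * w ∈ peirceV K e
  mul_mem_UV : ∀ u ∈ peirceU K e, ∀ v ∈ peirceV K e, u * v ∈ peirceU K e
  mul_mem_VV : ∀ v ∈ peirceV K e, ∀ x ∈ peirceV K e, v * x ∈ peirceU K e
  skew : ∀ u ∈ peirceU K e, ∀ w ∈ peirceU K e, ∀ v ∈ peirceV K e, u * (w * v) = -(w * (u * v))
  mul_VV : ∀ u ∈ peirceU K e, ∀ v ∈ peirceV K e, ∀ x ∈ peirceV K e, u * (v * x) = 0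
  cyclic : ∀ u ∈ peirceU K e, ∀ w ∈ peirceU K e, ∀ z ∈ peirceU K e,
    (u * w) * z + (w * z) * u + (z * u) * w = 0
  exchange : ∀ u ∈ peirceU K e, ∀ w ∈ peirceU K e, ∀ v ∈ peirceV K e, ∀ x ∈ peirceV K e,
    (u * v) * (w * x) = -((u * x) * (w * v))

theorem IsBernstein.peirceRelations (h2 : (2 : K) ≠ 0)
    (hA : IsBernstein ω) (he : e * e = e) (hω : ω e = 1) : PeirceRelations K e := by
  have hUN : ∀ u ∈ peirceU K e, ω u = 0 := fun u hu => peirceU_le_barideal h2 hω hu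
  have hVN : ∀ v ∈ peirceV K e, ω v = 0 := fun v hv => peirceV_le_barideal hω hv
  have hi : (2 : K) * (2 : K)⁻¹ = 1 := mul_inv_cancel₀ h2
  -- `two`, `three` and `four` are the linearized identity with that number of arguments in `N` and
  -- the others equal to `e`.
  have two : ∀ n m, ω n = 0 → ω m = 0 →
      (2 : K) • (e * (n * m)) + (4 : K) • ((e * n) * (e * m)) = n * m := by
    intro n m hn hm
    have h := hA.multilinear h2 e e n m
    rw [he, hω, hn, hm, mul_comm (e * m)] at h
    linear_combination (norm := module) h
  have three : ∀ n m p, ω n = 0 → ω m = 0 → ω p = 0 →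
      (e * n) * (m * p) + (e * m) * (n * p) + (e * p) * (n * m) = 0 := by
    intro n m p hn hm hp
    have h := hA.multilinear h2 e n m p
    rw [hn, hm, hp] at h
    refine smul_right_injective A h2 ?_
    dsimp only
    linear_combination (norm := module) h
  have four : ∀ n m p q, ω n = 0 → ω m = 0 → ω p = 0 → ω q = 0 →
      (n * m) * (p * q) + (n * p) * (m * q) + (n * q) * (m * p) = 0 := by
    intro n m p q hn hm hp hq
    have h := hA.multilinear h2 n m p q
    rw [hn, hm, hp, hq] at h
    refine smul_right_injective A h2 ?_
    dsimp only
    linear_combination (norm := module) h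
  have cyc : ∀ u ∈ peirceU K e, ∀ w ∈ peirceU K e, ∀ z ∈ peirceU K e,
      (u * w) * z + (w * z) * u + (z * u) * w = 0 := by
    intro u hu w hw z hz
    have h := three u w z (hUN u hu) (hUN w hw) (hUN z hz)
    rw [mem_peirceU.mp hu, mem_peirceU.mp hw, mem_peirceU.mp hz, smul_mul_assoc, smul_mul_assoc,
      smul_mul_assoc, ← smul_add, ← smul_add, smul_eq_zero_iff_right (inv_ne_zero h2)] at h
    rw [← h, mul_comm (u * w), mul_comm (w * z), mul_comm (z * u), mul_comm z u]
    abel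
  have mVV : ∀ v ∈ peirceV K e, ∀ x ∈ peirceV K e, v * x ∈ peirceU K e := by
    intro v hv x hx
    have h := two v x (hVN v hv) (hVN x hx)
    rw [mem_peirceV.mp hv, zero_mul, smul_zero, add_zero] at h
    rw [mem_peirceU]
    nth_rw 2 [← h]
    rw [smul_smul, inv_mul_cancel₀ h2, one_smul]
  have annVV : ∀ u ∈ peirceU K e, ∀ v ∈ peirceV K e, ∀ x ∈ peirceV K e, u * (v * x) = 0 := by
    intro u hu v hv x hx
    have h := three u v x (hUN u hu) (hVN v hv) (hVN x hx)
    rwa [mem_peirceU.mp hu, mem_peirceV.mp hv, mem_peirceV.mp hx, zero_mul, zero_mul, add_zero,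
      add_zero, smul_mul_assoc, smul_eq_zero_iff_right (inv_ne_zero h2)] at h
  refine ⟨?_, ?_, ?_, mVV, ?_, annVV, cyc, ?_⟩
  · rw [Submodule.disjoint_def]
    intro x hu hv
    rw [mem_peirceU, mem_peirceV.mp hv] at hu
    exact (smul_eq_zero_iff_right (inv_ne_zero h2)).mp hu.symm
  · intro u hu w hw
    have h := two u w (hUN u hu) (hUN w hw)
    rw [mem_peirceU.mp hu, mem_peirceU.mp hw, smul_mul_assoc, mul_smul_comm, smul_smul,
      smul_smul] at h
    have h4 : (4 : K) * ((2 : K)⁻¹ * (2 : K)⁻¹) = 1 := by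
      linear_combination (2 * (2 : K)⁻¹ + 1) * hi
    rw [mul_assoc, h4, one_smul, add_eq_right] at h
    exact (smul_eq_zero_iff_right h2).mp h
  · intro u hu v hv
    have h := two u v (hUN u hu) (hVN v hv)
    rw [mem_peirceV.mp hv, mul_zero, smul_zero, add_zero] at h
    rw [mem_peirceU]
    nth_rw 2 [← h]
    rw [smul_smul, inv_mul_cancel₀ h2, one_smul]
  · intro u hu w hw v hv
    have h := three u w v (hUN u hu) (hUN w hw) (hVN v hv)
    rw [mem_peirceU.mp hu, mem_peirceU.mp hw, mem_peirceV.mp hv, smul_mul_assoc, smul_mul_assoc,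
      zero_mul, add_zero, ← smul_add, smul_eq_zero_iff_right (inv_ne_zero h2)] at h
    exact eq_neg_of_add_eq_zero_left h
  · intro u hu w hw v hv x hx
    have h := four u w v x (hUN u hu) (hUN w hw) (hVN v hv) (hVN x hx)
    have hvx := mVV v hv x hx
    -- The remaining term `(u w)(v x)` vanishes: `v x` lies in `U` and annihilates `U`, so only this
    -- term survives in the cyclic identity.
    have h0 := cyc u hu w hw (v * x) hvx
    rw [mul_comm w, mul_comm (v * x) w, annVV w hw v hv x hx, mul_comm (v * x) u,
      annVV u hu v hv x hx, zero_mul, zero_mul, add_zero, add_zero] at h0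
    rw [h0, zero_add] at h
    exact eq_neg_of_add_eq_zero_left h

end Peirce

/-! ### Calculus of `V`-multiplications modulo `ann_U(U)` -/

namespace PeirceRelations

variable {K A : Type*} [Field K] [NonUnitalNonAssocCommRing A] [Module K A]
  [SMulCommClass K A A] {e : A}

theorem mul_mem_VU (h : PeirceRelations K e) {v u : A} (hv : v ∈ peirceV K e)
    (hu : u ∈ peirceU K e) : v * u ∈ peirceU K e :=
  mul_comm u v ▸ h.mul_mem_UV u hu v hv

theorem skew_left (h : PeirceRelations K e) {u w v : A} (hu : u ∈ peirceU K e)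
    (hw : w ∈ peirceU K e) (hv : v ∈ peirceV K e) : u * (v * w) = -((v * u) * w) := by
  rw [mul_comm v w, h.skew u hu w hw v hv, mul_comm w, mul_comm u v]

variable [IsScalarTower K A A]

theorem mul_VV_mem_annU (h : PeirceRelations K e) {v x : A} (hv : v ∈ peirceV K e)
    (hx : x ∈ peirceV K e) : v * x ∈ annU K e :=
  ⟨h.mul_mem_VV v hv x hx, fun w hw => by rw [mul_comm, h.mul_VV w hw v hv x hx]⟩

theorem mul_V_annU (h : PeirceRelations K e) {v l : A} (hv : v ∈ peirceV K e)
    (hl : l ∈ annU K e) : v * l ∈ annU K e := by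
  refine ⟨h.mul_mem_VU hv hl.1, fun w hw => ?_⟩
  rw [mul_comm, h.skew_left hw hl.1 hv, mul_comm (v * w), hl.2 _ (h.mul_mem_VU hv hw), neg_zero]

/-- Multiplying by `w ∈ U` and moving `v` and `x` across by skewness turns this into `exchange`. -/
theorem anticomm (h : PeirceRelations K e) {v x u : A} (hv : v ∈ peirceV K e)
    (hx : x ∈ peirceV K e) (hu : u ∈ peirceU K e) : v * (x * u) + x * (v * u) ∈ annU K e := by
  refine ⟨add_mem (h.mul_mem_VU hv (h.mul_mem_VU hx hu)) (h.mul_mem_VU hx (h.mul_mem_VU hv hu)),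
    fun w hw => ?_⟩
  have h1 := h.skew_left hw (h.mul_mem_VU hx hu) hv
  have h2 := h.skew_left hw (h.mul_mem_VU hv hu) hx
  have h3 := h.exchange w hw u hu v hv x hx
  rw [add_mul, mul_comm _ w, mul_comm _ w, h1, h2, mul_comm v w, mul_comm x u, h3,
    mul_comm x w, mul_comm v u]
  abel

theorem anticomm_triple (h : PeirceRelations K e) {v₁ v₂ v₃ x u : A} (hv₁ : v₁ ∈ peirceV K e)
    (hv₂ : v₂ ∈ peirceV K e) (hv₃ : v₃ ∈ peirceV K e) (hx : x ∈ peirceV K e)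
    (hu : u ∈ peirceU K e) :
    v₁ * (v₂ * (v₃ * (x * u))) + x * (v₁ * (v₂ * (v₃ * u))) ∈ annU K e := by
  have h3 := h.anticomm hv₃ hx hu
  have h2 := h.anticomm hv₂ hx (h.mul_mem_VU hv₃ hu)
  have h1 := h.anticomm hv₁ hx (h.mul_mem_VU hv₂ (h.mul_mem_VU hv₃ hu))
  have := add_mem (sub_mem (h.mul_V_annU hv₁ (h.mul_V_annU hv₂ h3)) (h.mul_V_annU hv₁ h2)) h1
  convert this using 1
  simp only [mul_add]
  abel

/-- Moving three skew operators across gives the sign `-1` and reverses their order. Reversing three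
anticommuting operators gives another `-1`; the error lies in `ann_U(U)` and is killed by `z`. -/
theorem triple_symm (h : PeirceRelations K e) {v₁ v₂ v₃ u z : A} (hv₁ : v₁ ∈ peirceV K e)
    (hv₂ : v₂ ∈ peirceV K e) (hv₃ : v₃ ∈ peirceV K e) (hu : u ∈ peirceU K e)
    (hz : z ∈ peirceU K e) :
    u * (v₁ * (v₂ * (v₃ * z))) = (v₁ * (v₂ * (v₃ * u))) * z := by
  have hvz := h.mul_mem_VU hv₃ hz
  have hv1u := h.mul_mem_VU hv₁ hu
  rw [h.skew_left hu (h.mul_mem_VU hv₂ hvz) hv₁, h.skew_left hv1u hvz hv₂,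
    h.skew_left (h.mul_mem_VU hv₂ hv1u) hz hv₃, neg_neg]
  have h3 := h.anticomm hv₃ hv₂ hv1u
  have h2 := h.mul_V_annU hv₂ (h.anticomm hv₃ hv₁ hu)
  have h1 := h.anticomm hv₂ hv₁ (h.mul_mem_VU hv₃ hu)
  have := (add_mem (sub_mem h3 h2) h1).2 z hz
  rw [← sub_eq_zero, ← neg_eq_zero, ← this]
  simp only [mul_add, add_mul, sub_mul]
  abel

/-- This is `cyclic` for `u`, `v₁(v₂(v₃ z))`, `y`, with the triple moved onto `y` in one term and
past `y u ∈ V` in another. -/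
theorem triple_cyclic (h : PeirceRelations K e) {v₁ v₂ v₃ u z y : A} (hv₁ : v₁ ∈ peirceV K e)
    (hv₂ : v₂ ∈ peirceV K e) (hv₃ : v₃ ∈ peirceV K e) (hu : u ∈ peirceU K e)
    (hz : z ∈ peirceU K e) (hy : y ∈ peirceU K e) :
    (u * (v₁ * (v₂ * (v₃ * z)))) * y + (z * (v₁ * (v₂ * (v₃ * y)))) * u
      - v₁ * (v₂ * (v₃ * ((y * u) * z))) ∈ annU K e := by
  have h1 := h.cyclic u hu _ (h.mul_mem_VU hv₁ (h.mul_mem_VU hv₂ (h.mul_mem_VU hv₃ hz))) y hy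
  have h2 := h.anticomm_triple hv₁ hv₂ hv₃ (h.mul_mem_UU y hy u hu) hz
  rw [h.triple_symm hv₁ hv₂ hv₃ hz hy]
  have h3 := neg_mem h2
  rw [← add_zero (-_), ← h1] at h3
  convert h3 using 1
  abel

/-- Modulo `ann_U(U)`, multiplication by `y (v₁ (v₂ (v₃ u)))` on `U` is, up to sign, multiplication
by `y u` followed by multiplication by `v₃`, `v₂` and `v₁`. -/
theorem mul_triple_mul (h : PeirceRelations K e) (h2 : (2 : K) ≠ 0) {v₁ v₂ v₃ u z y : A}
    (hv₁ : v₁ ∈ peirceV K e) (hv₂ : v₂ ∈ peirceV K e) (hv₃ : v₃ ∈ peirceV K e)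
    (hu : u ∈ peirceU K e) (hz : z ∈ peirceU K e) (hy : y ∈ peirceU K e) :
    (y * (v₁ * (v₂ * (v₃ * u)))) * z + v₁ * (v₂ * (v₃ * ((y * u) * z))) ∈ annU K e := by
  have e1 := h.triple_cyclic hv₁ hv₂ hv₃ hu hz hy
  have e2 := h.triple_cyclic hv₁ hv₂ hv₃ hz hy hu
  have e3 := h.triple_cyclic hv₁ hv₂ hv₃ hy hu hz
  have hc : v₁ * (v₂ * (v₃ * ((y * u) * z))) + v₁ * (v₂ * (v₃ * ((u * z) * y))) +
      v₁ * (v₂ * (v₃ * ((z * y) * u))) = 0 := by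
    rw [← mul_add, ← mul_add, ← mul_add, ← mul_add, ← mul_add, ← mul_add, h.cyclic y hy u hu z hz,
      mul_zero, mul_zero, mul_zero]
  -- `e1`, `e2`, `e3` control the pairwise sums of three terms; this combination isolates twice the
  -- wanted one.
  have := sub_mem (add_mem e2 e3) e1
  rw [← (annU K e).smul_mem_iff h2]
  convert this using 1
  linear_combination (norm := module) hc

/-- `V (V (V (V ((U U) U))))` is contained in `ann_U(U)`. -/
theorem quadruple_mul_mem_annU (h : PeirceRelations K e) (h2 : (2 : K) ≠ 0)
    {x v₁ v₂ v₃ u z y : A} (hx : x ∈ peirceV K e) (hv₁ : v₁ ∈ peirceV K e)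
    (hv₂ : v₂ ∈ peirceV K e) (hv₃ : v₃ ∈ peirceV K e) (hu : u ∈ peirceU K e)
    (hz : z ∈ peirceU K e) (hy : y ∈ peirceU K e) :
    x * (v₁ * (v₂ * (v₃ * ((y * u) * z)))) ∈ annU K e := by
  have hp := h.mul_mem_UU y hy u hu
  have hq := h.mul_mem_UU y hy _
    (h.mul_mem_VU hv₁ (h.mul_mem_VU hv₂ (h.mul_mem_VU hv₃ hu)))
  -- Modulo `ann_U(U)`, `y(v₁(v₂(v₃ u)))` acts as minus the composite of `v₁, v₂, v₃, y u`. As an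
  -- element of `V` it anticommutes with `x`; as a composite of four such operators it commutes with
  -- `x`. Hence twice the product vanishes.
  have e1 := h.mul_V_annU hx (h.mul_triple_mul h2 hv₁ hv₂ hv₃ hu hz hy)
  have e2 := h.mul_triple_mul h2 hv₁ hv₂ hv₃ hu (h.mul_mem_VU hx hz) hy
  have e3 := h.anticomm hx hq hz
  have e4 := h.anticomm_triple hv₁ hv₂ hv₃ hx (h.mul_mem_VU hp hz)
  have e5 := h.mul_V_annU hv₁ (h.mul_V_annU hv₂ (h.mul_V_annU hv₃ (h.anticomm hp hx hz)))
  have := add_mem (sub_mem (sub_mem (add_mem e1 e2) e3) e5) e4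
  rw [← (annU K e).smul_mem_iff h2]
  convert this using 1
  simp only [mul_add]
  module

theorem mul_annU (h : PeirceRelations K e) {n l : A} (hn : n ∈ peirceU K e ⊔ peirceV K e)
    (hl : l ∈ annU K e) : n * l ∈ annU K e := by
  obtain ⟨u, hu, v, hv, rfl⟩ := Submodule.mem_sup.mp hn
  rw [add_mul, mul_comm u, hl.2 u hu, zero_add]
  exact h.mul_V_annU hv hl

/-- The linearization of `x² x = 0` holds in the barideal modulo `ann_U(U)`. -/
theorem cubic (h : PeirceRelations K e) {n m p : A} (hn : n ∈ peirceU K e ⊔ peirceV K e)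
    (hm : m ∈ peirceU K e ⊔ peirceV K e) (hp : p ∈ peirceU K e ⊔ peirceV K e) :
    n * (m * p) + m * (n * p) + (n * m) * p ∈ annU K e := by
  obtain ⟨u, hu, v, hv, rfl⟩ := Submodule.mem_sup.mp hn
  obtain ⟨w, hw, x, hx, rfl⟩ := Submodule.mem_sup.mp hm
  obtain ⟨z, hz, y, hy, rfl⟩ := Submodule.mem_sup.mp hp
  have uuv : ∀ u ∈ peirceU K e, ∀ w ∈ peirceU K e, ∀ v ∈ peirceV K e,
      u * (w * v) + w * (u * v) + (u * w) * v ∈ annU K e := by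
    intro u hu w hw v hv
    rw [h.skew u hu w hw v hv, neg_add_cancel, zero_add]
    exact h.mul_VV_mem_annU (h.mul_mem_UU u hu w hw) hv
  have uvv : ∀ u ∈ peirceU K e, ∀ v ∈ peirceV K e, ∀ x ∈ peirceV K e,
      v * (x * u) + x * (v * u) + (v * x) * u ∈ annU K e := by
    intro u hu v hv x hx
    rw [mul_comm (v * x), h.mul_VV u hu v hv x hx, add_zero]
    exact h.anticomm hv hx hu
  have uuu : u * (w * z) + w * (u * z) + (u * w) * z = 0 := by
    rw [← h.cyclic u hu w hw z hz, mul_comm u (w * z), mul_comm w (u * z), mul_comm u z]; abel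
  have vvv : v * (x * y) + x * (v * y) + (v * x) * y ∈ annU K e :=
    add_mem (add_mem (h.mul_V_annU hv (h.mul_VV_mem_annU hx hy))
      (h.mul_V_annU hx (h.mul_VV_mem_annU hv hy)))
      (mul_comm y (v * x) ▸ h.mul_V_annU hy (h.mul_VV_mem_annU hv hx))
  have := add_mem vvv (add_mem (add_mem (uuv u hu w hw y hy)
    (add_mem (uuv u hu z hz x hx) (uuv w hw z hz v hv)))
    (add_mem (uvv u hu x hx y hy) (add_mem (uvv w hw v hv y hy) (uvv z hz v hv x hx))))
  rw [← add_zero (_ + _), ← uuu] at this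
  convert this using 1
  simp only [mul_add, add_mul]
  rw [mul_comm (w * z) v, mul_comm (x * y) u, mul_comm (u * z) x, mul_comm (v * y) w,
    mul_comm z x, mul_comm z (u * x), mul_comm z v, mul_comm z (w * v), mul_comm y u,
    mul_comm y (x * u), mul_comm y w, mul_comm y (v * w), mul_comm w v, mul_comm x u,
    mul_comm u z, mul_comm w z]
  abel

end PeirceRelations

/-! ### Finiteness from the chain conditions -/

section Chain

variable {K A : Type*} [Field K] [NonUnitalNonAssocCommRing A] [Module K A]

/-- Under a chain condition, a subspace `X` all of whose subspaces generate an ideal together with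
`Q` is finite-dimensional modulo `Q`. -/
theorem exists_finset_le_sup_span (hchain : IsNoetherianAlg K A ∨ IsArtinianAlg K A)
    {Q X : Submodule K A} (hX : ∀ Y ≤ X, IsIdeal (Q ⊔ Y)) :
    ∃ s : Finset A, (s : Set A) ⊆ X ∧ X ≤ Q ⊔ Submodule.span K (s : Set A) := by
  classical
  set R : Submodule K X := Q.comap X.subtype with hR
  -- `J` embeds the subspaces of `X / (X ∩ Q)` into the ideals of `A`, so the chain condition passes
  -- to this quotient vector space.
  let J : Submodule K (X ⧸ R) → Submodule K A :=
    fun Z => Q ⊔ (Z.comap R.mkQ).map X.subtype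
  have hJI : ∀ Z, IsIdeal (J Z) := fun Z => hX _ (Submodule.map_subtype_le X _)
  have hJmono : Monotone J := fun Z Z' hZ =>
    sup_le_sup_left (Submodule.map_mono (Submodule.comap_mono hZ)) _
  have hJinj : Function.Injective J := by
    have key : ∀ Z Z', J Z ≤ J Z' → Z ≤ Z' := by
      intro Z Z' hle z hz
      obtain ⟨x, rfl⟩ := R.mkQ_surjective z
      have hx : (x : A) ∈ J Z :=
        Submodule.mem_sup_right (Submodule.mem_map_of_mem (f := X.subtype) hz)
      obtain ⟨q, hq, y, ⟨y', hy', rfl⟩, hqy⟩ := Submodule.mem_sup.mp (hle hx)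
      have hmem : x - y' ∈ R := by
        rw [hR, Submodule.mem_comap, map_sub]
        rwa [Submodule.subtype_apply, ← hqy, add_sub_cancel_right]
      have heq : R.mkQ x = R.mkQ y' := (Submodule.Quotient.eq R).mpr hmem
      rw [heq]
      exact hy'
    exact fun Z Z' hZ => le_antisymm (key _ _ hZ.le) (key _ _ hZ.ge)
  have hfin : Module.Finite K (X ⧸ R) := by
    rcases hchain with hN | hA
    · have : IsNoetherian K (X ⧸ R) := by
        rw [← monotone_stabilizes_iff_noetherian]
        intro f
        obtain ⟨n, hn⟩ := hN (fun n => J (f n)) (fun n => hJI _) (hJmono.comp f.monotone)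
        exact ⟨n, fun m hm => hJinj (hn m hm).symm⟩
      infer_instance
    · have : IsArtinian K (X ⧸ R) := by
        rw [← monotone_stabilizes_iff_artinian]
        intro f
        obtain ⟨n, hn⟩ := hA (fun n => J (OrderDual.ofDual (f n))) (fun n => hJI _)
          (fun a b hab => hJmono (f.monotone hab))
        exact ⟨n, fun m hm => hJinj (hn m hm).symm⟩
      exact ((IsSemisimpleModule.finite_tfae (R := K) (M := X ⧸ R)).out 2 0).mp this
  obtain ⟨t, ht⟩ := hfin.fg_top
  obtain ⟨s, -, rfl⟩ := Finset.subset_set_image_iff.mp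
    (show (t : Set (X ⧸ R)) ⊆ R.mkQ '' Set.univ from
      fun z _ => by simpa using R.mkQ_surjective z)
  refine ⟨s.image X.subtype, ?_, fun x hx => ?_⟩
  · intro x hx
    obtain ⟨y, -, rfl⟩ := Finset.mem_image.mp (Finset.mem_coe.mp hx)
    exact y.2
  · have hmem : R.mkQ ⟨x, hx⟩ ∈ Submodule.span K ((s.image R.mkQ : Finset _) : Set (X ⧸ R)) :=
      ht ▸ Submodule.mem_top
    rw [Finset.coe_image, Submodule.span_image] at hmem
    obtain ⟨y, hy, hyx⟩ := hmem
    have hd : (⟨x, hx⟩ : X) - y ∈ R := (Submodule.Quotient.eq R).mp hyx.symm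
    rw [Finset.coe_image, Submodule.span_image]
    refine Submodule.mem_sup.mpr ⟨_, hd, _, Submodule.mem_map_of_mem hy, ?_⟩
    simp

end Chain

/-! ### Products of subspaces -/

section MulSub

variable {K A : Type*} [Field K] [NonUnitalNonAssocCommRing A] [Module K A]
  [SMulCommClass K A A] [IsScalarTower K A A]

theorem mul_mem_mulSub {P Q : Submodule K A} {p q : A} (hp : p ∈ P) (hq : q ∈ Q) :
    p * q ∈ mulSub P Q :=
  Submodule.apply_mem_map₂ (LinearMap.mul K A) hp hq

theorem mulSub_le {P Q R : Submodule K A} : mulSub P Q ≤ R ↔ ∀ p ∈ P, ∀ q ∈ Q, p * q ∈ R :=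
  Submodule.map₂_le

theorem mulSub_mono {P P' Q Q' : Submodule K A} (hP : P ≤ P') (hQ : Q ≤ Q') :
    mulSub P Q ≤ mulSub P' Q' :=
  Submodule.map₂_le_map₂ hP hQ

end MulSub

/-! ### `N` modulo `N²` -/

section Finiteness

variable {K A : Type*} [Field K] [NonUnitalNonAssocCommRing A] [Module K A]
  {ω : A →ₙₐ[K] K} {e : A}

theorem mul_mem_barideal {a n : A} (hn : n ∈ barideal ω) : a * n ∈ barideal ω := by
  rw [mem_barideal, map_mul, mem_barideal.mp hn, mul_zero]

variable [SMulCommClass K A A] [IsScalarTower K A A]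

theorem mulSub_le_barideal (P : Submodule K A) : mulSub (barideal ω) P ≤ barideal ω :=
  mulSub_le.mpr fun _ hp q _ => mul_comm q _ ▸ mul_mem_barideal hp

/-- A subspace containing `N²`, contained in `N` and stable under `e` is an ideal. -/
theorem isIdeal_of_mulSub_le (hω : ω e = 1) {J : Submodule K A}
    (hJ : mulSub (barideal ω) (barideal ω) ≤ J) (hJN : J ≤ barideal ω)
    (heJ : ∀ x ∈ J, e * x ∈ J) : IsIdeal J := by
  intro a x hx
  have hn : a - ω a • e ∈ barideal ω := by
    rw [mem_barideal, map_sub, map_smul, hω, smul_eq_mul, mul_one, sub_self]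
  have h := add_mem (hJ (mul_mem_mulSub hn (hJN hx))) (J.smul_mem (ω a) (heJ x hx))
  rwa [sub_mul, smul_mul_assoc, sub_add_cancel] at h

theorem PeirceRelations.mul_mem_mulSub_barideal (h : PeirceRelations K e)
    (hN : barideal ω = peirceU K e ⊔ peirceV K e) {x : A}
    (hx : x ∈ mulSub (barideal ω) (barideal ω)) :
    e * x ∈ mulSub (barideal ω) (barideal ω) := by
  have hU : peirceU K e ≤ barideal ω := hN ▸ le_sup_left
  have hV : peirceV K e ≤ barideal ω := hN ▸ le_sup_right
  suffices H : mulSub (barideal ω) (barideal ω) ≤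
      (mulSub (barideal ω) (barideal ω)).comap (LinearMap.mulLeft K e) from H hx
  refine mulSub_le.mpr fun n hn m hm => ?_
  rw [hN] at hn hm
  obtain ⟨u, hu, v, hv, rfl⟩ := Submodule.mem_sup.mp hn
  obtain ⟨w, hw, y, hy, rfl⟩ := Submodule.mem_sup.mp hm
  rw [Submodule.mem_comap, LinearMap.mulLeft_apply, add_mul, mul_add, mul_add, mul_add, mul_add,
    mul_add, mem_peirceV.mp (h.mul_mem_UU u hu w hw), mem_peirceU.mp (h.mul_mem_UV u hu y hy),
    mem_peirceU.mp (h.mul_mem_VU hv hw), mem_peirceU.mp (h.mul_mem_VV v hv y hy), zero_add]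
  exact add_mem (Submodule.smul_mem _ _ (mul_mem_mulSub (hU hu) (hV hy)))
    (add_mem (Submodule.smul_mem _ _ (mul_mem_mulSub (hV hv) (hU hw)))
      (Submodule.smul_mem _ _ (mul_mem_mulSub (hV hv) (hV hy))))

/-- Under a chain condition, `N` is finite-dimensional modulo `N²`. -/
theorem PeirceRelations.exists_barideal_eq_sup_span (h : PeirceRelations K e) (hω : ω e = 1)
    (hN : barideal ω = peirceU K e ⊔ peirceV K e)
    (hchain : IsNoetherianAlg K A ∨ IsArtinianAlg K A) :
    ∃ s : Finset A, barideal ω =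
      mulSub (barideal ω) (barideal ω) ⊔ Submodule.span K (s : Set A) := by
  classical
  -- `U` and `V` are treated separately: where `e` acts as a scalar, every subspace together with
  -- `N²` is an ideal.
  have key : ∀ X ≤ barideal ω, ∀ c : K, (∀ x ∈ X, e * x = c • x) →
      ∃ s : Finset A, (s : Set A) ⊆ X ∧
        X ≤ mulSub (barideal ω) (barideal ω) ⊔ Submodule.span K (s : Set A) := by
    intro X hX c hc
    refine exists_finset_le_sup_span hchain fun Y hY => ?_
    refine isIdeal_of_mulSub_le hω le_sup_left
      (sup_le (mulSub_le_barideal _) (hY.trans hX)) fun x hx => ?_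
    obtain ⟨q, hq, y, hy, rfl⟩ := Submodule.mem_sup.mp hx
    rw [mul_add, hc y (hY hy)]
    exact add_mem (Submodule.mem_sup_left (h.mul_mem_mulSub_barideal hN hq))
      (Submodule.mem_sup_right (Y.smul_mem c hy))
  obtain ⟨s, hs, hUs⟩ := key (peirceU K e) (hN ▸ le_sup_left) _ fun _ hx => mem_peirceU.mp hx
  obtain ⟨t, ht, hVt⟩ := key (peirceV K e) (hN ▸ le_sup_right) 0
    fun x hx => (mem_peirceV.mp hx).trans (zero_smul K x).symm
  have hUN : peirceU K e ≤ barideal ω := hN ▸ le_sup_left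
  have hVN : peirceV K e ≤ barideal ω := hN ▸ le_sup_right
  refine ⟨s ∪ t, le_antisymm ?_ (sup_le (mulSub_le_barideal _) ?_)⟩
  · rw [Finset.coe_union, Submodule.span_union]
    nth_rw 1 [hN]
    exact sup_le (hUs.trans (sup_le_sup_left le_sup_left _))
      (hVt.trans (sup_le_sup_left le_sup_right _))
  · rw [Submodule.span_le, Finset.coe_union]
    exact Set.union_subset (hs.trans hUN) (ht.trans hVN)

end Finiteness

/-! ### Reduction to `N²` and the vanishing argument -/

namespace PeirceRelations

variable {K A : Type*} [Field K] [NonUnitalNonAssocCommRing A] [Module K A]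
  [SMulCommClass K A A] {e : A}

theorem mem_left_of_mem_sup (h : PeirceRelations K e) {P R : Submodule K A}
    (hP : P ≤ peirceU K e) (hR : R ≤ peirceV K e) {x : A} (hx : x ∈ peirceU K e)
    (hxPR : x ∈ P ⊔ R) : x ∈ P := by
  obtain ⟨p, hp, r, hr, rfl⟩ := Submodule.mem_sup.mp hxPR
  have hrU : r ∈ peirceU K e := by simpa using sub_mem hx (hP hp)
  rw [Submodule.disjoint_def.mp h.disjoint r hrU (hR hr), add_zero]
  exact hp

theorem mem_right_of_mem_sup (h : PeirceRelations K e) {P R : Submodule K A}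
    (hP : P ≤ peirceU K e) (hR : R ≤ peirceV K e) {x : A} (hx : x ∈ peirceV K e)
    (hxPR : x ∈ P ⊔ R) : x ∈ R := by
  obtain ⟨p, hp, r, hr, rfl⟩ := Submodule.mem_sup.mp hxPR
  have hpV : p ∈ peirceV K e := by simpa using sub_mem hx (hR hr)
  rw [Submodule.disjoint_def.mp h.disjoint p (hP hp) hpV, zero_add]
  exact hr

variable [IsScalarTower K A A]

theorem annU_le_sup : annU K e ≤ peirceU K e ⊔ peirceV K e :=
  fun _ hl => Submodule.mem_sup_left hl.1

theorem mul_mem_sup (h : PeirceRelations K e) {n m : A} (hn : n ∈ peirceU K e ⊔ peirceV K e)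
    (hm : m ∈ peirceU K e ⊔ peirceV K e) :
    n * m ∈ (mulSub (peirceV K e) (peirceU K e) ⊔ annU K e) ⊔
      mulSub (peirceU K e) (peirceU K e) := by
  obtain ⟨u, hu, v, hv, rfl⟩ := Submodule.mem_sup.mp hn
  obtain ⟨w, hw, x, hx, rfl⟩ := Submodule.mem_sup.mp hm
  rw [add_mul, mul_add, mul_add, mul_comm u x]
  exact add_mem
    (add_mem (Submodule.mem_sup_right (mul_mem_mulSub hu hw))
      (Submodule.mem_sup_left (Submodule.mem_sup_left (mul_mem_mulSub hx hu))))
    (add_mem (Submodule.mem_sup_left (Submodule.mem_sup_left (mul_mem_mulSub hv hw)))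
      (Submodule.mem_sup_left (Submodule.mem_sup_right (h.mul_VV_mem_annU hv hx))))

theorem mulSub_VU_sup_annU_le (h : PeirceRelations K e) :
    mulSub (peirceV K e) (peirceU K e) ⊔ annU K e ≤ peirceU K e :=
  sup_le (mulSub_le.mpr fun _ hv _ hu => h.mul_mem_VU hv hu) fun _ hl => hl.1

theorem mulSub_UU_le (h : PeirceRelations K e) :
    mulSub (peirceU K e) (peirceU K e) ≤ peirceV K e :=
  mulSub_le.mpr fun u hu w hw => h.mul_mem_UU u hu w hw

theorem mul_mem_N (h : PeirceRelations K e) {n m : A} (hn : n ∈ peirceU K e ⊔ peirceV K e)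
    (hm : m ∈ peirceU K e ⊔ peirceV K e) : n * m ∈ peirceU K e ⊔ peirceV K e :=
  sup_le_sup h.mulSub_VU_sup_annU_le h.mulSub_UU_le (h.mul_mem_sup hn hm)

section Reduction

variable {M : Submodule K A}

/-- Put `Z = Q M + ann_U(U)`. Since `N² ⊆ Q`, `cubic` gives `t Z ⊆ Z` and `t(t M) ⊆ Z`; substituting
`M ⊆ t M + Z` into itself yields `M ⊆ Z`. -/
theorem le_mulSub_of_le_mulSub_sup_span_singleton (h : PeirceRelations K e) (h2 : (2 : K) ≠ 0)
    (hMN : M ≤ peirceU K e ⊔ peirceV K e)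
    (hNM : ∀ n ∈ peirceU K e ⊔ peirceV K e, ∀ m ∈ M, n * m ∈ M) {Q : Submodule K A}
    (hQN : Q ≤ peirceU K e ⊔ peirceV K e)
    (hNQ : mulSub (peirceU K e ⊔ peirceV K e) (peirceU K e ⊔ peirceV K e) ≤ Q) {t : A}
    (ht : t ∈ peirceU K e ⊔ peirceV K e)
    (hM : M ≤ mulSub (Q ⊔ Submodule.span K {t}) M ⊔ annU K e) :
    M ≤ mulSub Q M ⊔ annU K e := by
  have hZ : mulSub Q M ⊔ annU K e ≤
      (mulSub Q M ⊔ annU K e).comap (LinearMap.mulLeft K t) := by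
    refine sup_le (mulSub_le.mpr fun q hq m hm => ?_)
      fun l hl => Submodule.mem_sup_right (h.mul_annU ht hl)
    rw [Submodule.mem_comap, LinearMap.mulLeft_apply]
    have h1 := h.cubic ht (hQN hq) (hMN hm)
    have h3 := mul_mem_mulSub hq (hNM t ht m hm)
    have h4 := mul_mem_mulSub (hNQ (mul_mem_mulSub ht (hQN hq))) hm
    have := sub_mem (sub_mem (Submodule.mem_sup_right h1) (Submodule.mem_sup_left h3))
      (Submodule.mem_sup_left (T := annU K e) h4)
    convert this using 1
    abel
  have hdec : M ≤ M.map (LinearMap.mulLeft K t) ⊔ (mulSub Q M ⊔ annU K e) := by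
    refine hM.trans (sup_le (mulSub_le.mpr fun p hp m hm => ?_) (le_sup_right.trans le_sup_right))
    obtain ⟨q, hq, r, hr, rfl⟩ := Submodule.mem_sup.mp hp
    obtain ⟨c, rfl⟩ := Submodule.mem_span_singleton.mp hr
    rw [add_mul, smul_mul_assoc, ← mul_smul_comm]
    exact add_mem
      (Submodule.mem_sup_right (Submodule.mem_sup_left (mul_mem_mulSub hq hm)))
      (Submodule.mem_sup_left ⟨c • m, M.smul_mem c hm, rfl⟩)
  have hsq : ∀ m ∈ M, t * (t * m) ∈ mulSub Q M ⊔ annU K e := by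
    intro m hm
    have h1 := h.cubic ht ht (hMN hm)
    have h3 := mul_mem_mulSub (hNQ (mul_mem_mulSub ht ht)) hm
    rw [← Submodule.smul_mem_iff _ h2]
    have := sub_mem (Submodule.mem_sup_right h1) (Submodule.mem_sup_left (T := annU K e) h3)
    convert this using 1
    module
  intro m hm
  obtain ⟨-, ⟨m₁, hm₁, rfl⟩, z, hz, rfl⟩ := Submodule.mem_sup.mp (hdec hm)
  obtain ⟨-, ⟨m₂, hm₂, rfl⟩, z', hz', rfl⟩ := Submodule.mem_sup.mp (hdec hm₁)
  refine add_mem ?_ hz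
  rw [LinearMap.mulLeft_apply, LinearMap.mulLeft_apply, mul_add]
  exact add_mem (hsq m₂ hm₂) (hZ hz')

theorem le_mulSub_of_le_mulSub_sup_span (h : PeirceRelations K e) (h2 : (2 : K) ≠ 0)
    (hMN : M ≤ peirceU K e ⊔ peirceV K e)
    (hNM : ∀ n ∈ peirceU K e ⊔ peirceV K e, ∀ m ∈ M, n * m ∈ M) (s : Finset A) :
    ∀ {Q : Submodule K A}, Q ≤ peirceU K e ⊔ peirceV K e →
      mulSub (peirceU K e ⊔ peirceV K e) (peirceU K e ⊔ peirceV K e) ≤ Q →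
      Submodule.span K (s : Set A) ≤ peirceU K e ⊔ peirceV K e →
      M ≤ mulSub (Q ⊔ Submodule.span K (s : Set A)) M ⊔ annU K e →
      M ≤ mulSub Q M ⊔ annU K e := by
  classical
  induction s using Finset.induction_on with
  | empty =>
    intro Q _ _ _ hM
    simpa using hM
  | insert t s _ ih =>
    intro Q hQN hNQ hs hM
    rw [Finset.coe_insert, Submodule.span_insert] at hs hM
    rw [← sup_assoc] at hM
    have htN : Submodule.span K {t} ≤ peirceU K e ⊔ peirceV K e := le_sup_left.trans hs
    exact h.le_mulSub_of_le_mulSub_sup_span_singleton h2 hMN hNM hQN hNQ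
      (htN (Submodule.mem_span_singleton_self t))
      -- The other generators are removed first, with `t` absorbed into `Q`.
      (ih (sup_le hQN htN) (hNQ.trans le_sup_left) (le_sup_right.trans hs) hM)

/-- A graded ideal `M` of `N` with `M = N² M` modulo `ann_U(U)` lies in `ann_U(U)`. -/
theorem le_annU_of_le_mulSub_mulSub (h : PeirceRelations K e) (h2 : (2 : K) ≠ 0)
    (hMN : M ≤ peirceU K e ⊔ peirceV K e)
    (hNM : ∀ n ∈ peirceU K e ⊔ peirceV K e, ∀ m ∈ M, n * m ∈ M)
    (hgr : ∀ a ∈ peirceU K e, ∀ b ∈ peirceV K e, a + b ∈ M → a ∈ M)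
    (hM : M ≤ mulSub (mulSub (peirceU K e ⊔ peirceV K e) (peirceU K e ⊔ peirceV K e)) M ⊔
      annU K e) : M ≤ annU K e := by
  have hUN : peirceU K e ≤ peirceU K e ⊔ peirceV K e := le_sup_left
  have hVN : peirceV K e ≤ peirceU K e ⊔ peirceV K e := le_sup_right
  have hM' : M ≤ mulSub (peirceU K e ⊔ peirceV K e) M ⊔ annU K e :=
    hM.trans (sup_le_sup_right
      (mulSub_mono (mulSub_le.mpr fun n hn m hm => h.mul_mem_N hn hm) le_rfl) _)
  have hsq : mulSub (peirceU K e ⊔ peirceV K e) (peirceU K e ⊔ peirceV K e) ≤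
      (mulSub (peirceV K e) (peirceU K e) ⊔ annU K e) ⊔
        mulSub (peirceU K e) (peirceU K e) :=
    mulSub_le.mpr fun n hn m hm => h.mul_mem_sup hn hm
  have hdec : ∀ m ∈ M, ∃ a ∈ peirceU K e, ∃ b ∈ peirceV K e, a ∈ M ∧ b ∈ M ∧ a + b = m := by
    intro m hm
    obtain ⟨a, ha, b, hb, rfl⟩ := Submodule.mem_sup.mp (hMN hm)
    have haM := hgr a ha b hb hm
    exact ⟨a, ha, b, hb, haM, by simpa using sub_mem hm haM, rfl⟩
  have hbUU : ∀ b ∈ peirceV K e, b ∈ M → b ∈ mulSub (peirceU K e) (peirceU K e) := by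
    intro b hb hbM
    refine h.mem_right_of_mem_sup h.mulSub_VU_sup_annU_le h.mulSub_UU_le hb ?_
    exact sup_le (mulSub_le.mpr fun n hn m hm => h.mul_mem_sup hn (hMN hm))
      (le_sup_right.trans le_sup_left) (hM' hbM)
  have hUUU : ∀ a ∈ peirceU K e, a ∈ M →
      a ∈ mulSub (mulSub (peirceU K e) (peirceU K e)) (peirceU K e) ⊔ annU K e := by
    intro a ha haM
    have hle : mulSub (mulSub (peirceU K e) (peirceU K e)) (peirceU K e) ⊔ annU K e ≤
        peirceU K e :=
      sup_le (mulSub_le.mpr fun v hv u hu => h.mul_mem_VU (h.mulSub_UU_le hv) hu) fun l hl => hl.1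
    refine h.mem_left_of_mem_sup hle le_rfl ha ?_
    suffices H : M ≤ mulSub (mulSub (peirceU K e) (peirceU K e)) (peirceU K e) ⊔ annU K e ⊔
        peirceV K e from H haM
    refine hM.trans (sup_le (mulSub_le.mpr fun p hp m hm => ?_) (le_sup_right.trans le_sup_left))
    obtain ⟨p₁, hp₁, p₂, hp₂, rfl⟩ := Submodule.mem_sup.mp (hsq hp)
    obtain ⟨a, ha, b, hb, haM, hbM, rfl⟩ := hdec m hm
    have hp₁U := h.mulSub_VU_sup_annU_le hp₁
    rw [add_mul, mul_add, mul_add, mul_comm p₁ b]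
    exact add_mem
      (add_mem (Submodule.mem_sup_right (h.mul_mem_UU _ hp₁U a ha))
        (Submodule.mem_sup_left (Submodule.mem_sup_left
          (mul_mem_mulSub (hbUU b hb hbM) hp₁U))))
      (add_mem (Submodule.mem_sup_left (Submodule.mem_sup_left (mul_mem_mulSub hp₂ ha)))
        (Submodule.mem_sup_left (Submodule.mem_sup_right
          (h.mul_VV_mem_annU (h.mulSub_UU_le hp₂) hb))))
  have hVM : ∀ a ∈ peirceU K e, a ∈ M →
      a ∈ mulSub (peirceV K e) (M ⊓ peirceU K e) ⊔ annU K e := by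
    intro a ha haM
    have hle : mulSub (peirceV K e) (M ⊓ peirceU K e) ⊔ annU K e ≤ peirceU K e :=
      sup_le (mulSub_le.mpr fun v hv u hu => h.mul_mem_VU hv hu.2) fun l hl => hl.1
    refine h.mem_left_of_mem_sup hle le_rfl ha ?_
    suffices H : M ≤ mulSub (peirceV K e) (M ⊓ peirceU K e) ⊔ annU K e ⊔ peirceV K e from H haM
    refine hM.trans (sup_le (mulSub_le.mpr fun p hp m hm => ?_) (le_sup_right.trans le_sup_left))
    obtain ⟨p₁, hp₁, p₂, hp₂, rfl⟩ := Submodule.mem_sup.mp (hsq hp)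
    obtain ⟨a, ha, b, hb, haM, hbM, rfl⟩ := hdec m hm
    have hp₂V := h.mulSub_UU_le hp₂
    -- Anticommutation rewrites `b(v u)` as `-v(b u)`, where `b u` lies in `M ∩ U` because `b ∈ M`.
    have hb₁ : mulSub (peirceV K e) (peirceU K e) ⊔ annU K e ≤
        (mulSub (peirceV K e) (M ⊓ peirceU K e) ⊔ annU K e).comap (LinearMap.mulLeft K b) := by
      refine sup_le (mulSub_le.mpr fun v hv u hu => ?_)
        fun l hl => Submodule.mem_sup_right (h.mul_V_annU hb hl)
      have hbu : b * u ∈ M ⊓ peirceU K e :=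
        ⟨mul_comm u b ▸ hNM u (hUN hu) b hbM, h.mul_mem_VU hb hu⟩
      have := sub_mem (Submodule.mem_sup_right (h.anticomm hb hv hu))
        (Submodule.mem_sup_left (T := annU K e) (mul_mem_mulSub hv hbu))
      rwa [add_sub_cancel_right] at this
    rw [add_mul, mul_add, mul_add, mul_comm p₁ b]
    exact add_mem
      (add_mem (Submodule.mem_sup_right
          (h.mul_mem_UU _ (h.mulSub_VU_sup_annU_le hp₁) a ha))
        (Submodule.mem_sup_left (hb₁ hp₁)))
      (add_mem (Submodule.mem_sup_left (Submodule.mem_sup_left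
          (mul_mem_mulSub hp₂V ⟨haM, ha⟩)))
        (Submodule.mem_sup_left (Submodule.mem_sup_right (h.mul_VV_mem_annU hp₂V hb))))
  -- As `M ∩ U ⊆ V(M ∩ U) + ann_U(U)`, a string of `V`-multiplications sending `M ∩ U` into
  -- `ann_U(U)` can lose its innermost factor. `s4` to `s0` descend from four factors to none.
  have desc : ∀ f : A →ₗ[K] A, (∀ l ∈ annU K e, f l ∈ annU K e) →
      (∀ v ∈ peirceV K e, ∀ a ∈ peirceU K e, a ∈ M → f (v * a) ∈ annU K e) →
      ∀ a ∈ peirceU K e, a ∈ M → f a ∈ annU K e := by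
    intro f hfL hf a ha haM
    have : mulSub (peirceV K e) (M ⊓ peirceU K e) ⊔ annU K e ≤ (annU K e).comap f :=
      sup_le (mulSub_le.mpr fun v hv a ha => hf v hv a ha.2 ha.1) hfL
    exact this (hVM a ha haM)
  have s4 : ∀ x ∈ peirceV K e, ∀ v₁ ∈ peirceV K e, ∀ v₂ ∈ peirceV K e, ∀ v₃ ∈ peirceV K e,
      ∀ a ∈ peirceU K e, a ∈ M → x * (v₁ * (v₂ * (v₃ * a))) ∈ annU K e := by
    intro x hx v₁ hv₁ v₂ hv₂ v₃ hv₃ a ha haM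
    have hle : mulSub (mulSub (peirceU K e) (peirceU K e)) (peirceU K e) ⊔ annU K e ≤
        (annU K e).comap (LinearMap.mulLeft K x ∘ₗ LinearMap.mulLeft K v₁ ∘ₗ
          LinearMap.mulLeft K v₂ ∘ₗ LinearMap.mulLeft K v₃) := by
      refine sup_le (mulSub_le.mpr fun q hq z hz => ?_) fun l hl =>
        h.mul_V_annU hx (h.mul_V_annU hv₁ (h.mul_V_annU hv₂ (h.mul_V_annU hv₃ hl)))
      have hq' : mulSub (peirceU K e) (peirceU K e) ≤
          ((annU K e).comap (LinearMap.mulLeft K x ∘ₗ LinearMap.mulLeft K v₁ ∘ₗ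
            LinearMap.mulLeft K v₂ ∘ₗ LinearMap.mulLeft K v₃)).comap
              (LinearMap.mulRight K z) :=
        mulSub_le.mpr fun y hy u hu => h.quadruple_mul_mem_annU h2 hx hv₁ hv₂ hv₃ hu hz hy
      exact hq' hq
    exact hle (hUUU a ha haM)
  have s3 : ∀ x ∈ peirceV K e, ∀ v₁ ∈ peirceV K e, ∀ v₂ ∈ peirceV K e,
      ∀ a ∈ peirceU K e, a ∈ M → x * (v₁ * (v₂ * a)) ∈ annU K e :=
    fun x hx v₁ hv₁ v₂ hv₂ => desc
      (LinearMap.mulLeft K x ∘ₗ LinearMap.mulLeft K v₁ ∘ₗ LinearMap.mulLeft K v₂)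
      (fun l hl => h.mul_V_annU hx (h.mul_V_annU hv₁ (h.mul_V_annU hv₂ hl)))
      (s4 x hx v₁ hv₁ v₂ hv₂)
  have s2 : ∀ x ∈ peirceV K e, ∀ v ∈ peirceV K e, ∀ a ∈ peirceU K e, a ∈ M →
      x * (v * a) ∈ annU K e :=
    fun x hx v hv => desc (LinearMap.mulLeft K x ∘ₗ LinearMap.mulLeft K v)
      (fun l hl => h.mul_V_annU hx (h.mul_V_annU hv hl)) (s3 x hx v hv)
  have s1 : ∀ x ∈ peirceV K e, ∀ a ∈ peirceU K e, a ∈ M → x * a ∈ annU K e :=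
    fun x hx => desc (LinearMap.mulLeft K x) (fun l hl => h.mul_V_annU hx hl) (s2 x hx)
  have s0 : ∀ a ∈ peirceU K e, a ∈ M → a ∈ annU K e :=
    desc LinearMap.id (fun l hl => hl) s1
  have hMU : M ≤ peirceU K e := by
    refine hM'.trans (sup_le (mulSub_le.mpr fun n hn m hm => ?_) fun l hl => hl.1)
    obtain ⟨u, hu, v, hv, rfl⟩ := Submodule.mem_sup.mp hn
    obtain ⟨a, ha, b, hb, haM, hbM, rfl⟩ := hdec m hm
    rw [add_mul, mul_add, mul_comm u a, (s0 a ha haM).2 u hu, zero_add, mul_add]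
    exact add_mem (h.mul_mem_UV u hu b hb)
      (add_mem (h.mul_mem_VU hv ha) (h.mul_mem_VV v hv b hb))
  exact fun m hm => s0 m (hMU hm) hm

end Reduction

/-- If `N` is finite-dimensional modulo `N²`, then every subspace `X` of `N` with
`X ⊆ N X + ann_U(U)` lies in `ann_U(U)`. -/
theorem le_annU_of_le_mulSub (h : PeirceRelations K e) (h2 : (2 : K) ≠ 0) {s : Finset A}
    (hs : peirceU K e ⊔ peirceV K e =
      mulSub (peirceU K e ⊔ peirceV K e) (peirceU K e ⊔ peirceV K e) ⊔
        Submodule.span K (s : Set A))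
    {X : Submodule K A} (hXN : X ≤ peirceU K e ⊔ peirceV K e)
    (hX : X ≤ mulSub (peirceU K e ⊔ peirceV K e) X ⊔ annU K e) : X ≤ annU K e := by
  have hUN : peirceU K e ≤ peirceU K e ⊔ peirceV K e := le_sup_left
  have hVN : peirceV K e ≤ peirceU K e ⊔ peirceV K e := le_sup_right
  set N := peirceU K e ⊔ peirceV K e with hN
  -- Unlike `X`, the greatest fixed point is stable under `N` and graded. Intersecting with `N`
  -- keeps all values inside `N`.
  let Φ : Submodule K A →o Submodule K A :=
    ⟨fun Y => mulSub N (Y ⊓ N) ⊔ annU K e,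
      fun Y Y' hY => sup_le_sup_right (mulSub_mono le_rfl (inf_le_inf_right _ hY)) _⟩
  have hle : ∀ Y ≤ N, Y ≤ mulSub N Y ⊔ annU K e → Y ≤ Φ.gfp := by
    intro Y hYN hY
    refine Φ.le_gfp ?_
    change Y ≤ mulSub N (Y ⊓ N) ⊔ annU K e
    rwa [inf_eq_left.mpr hYN]
  have hfix : mulSub N (Φ.gfp ⊓ N) ⊔ annU K e = Φ.gfp := Φ.map_gfp
  have hMN : Φ.gfp ≤ N := hfix.ge.trans
    (sup_le (mulSub_le.mpr fun n hn m hm => h.mul_mem_N hn hm.2) annU_le_sup)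
  rw [inf_eq_left.mpr hMN] at hfix
  have hXM : X ≤ Φ.gfp := hle X hXN hX
  generalize Φ.gfp = M at hle hfix hMN hXM
  have hNM : ∀ n ∈ N, ∀ m ∈ M, n * m ∈ M := fun n hn m hm =>
    hfix.le (Submodule.mem_sup_left (mul_mem_mulSub hn hm))
  -- By maximality it suffices that `M + e M` satisfies the same inclusion; stability under `e` then
  -- gives the grading.
  have heM : M ⊔ M.map (LinearMap.mulLeft K e) ≤ M := by
    refine hle _ (sup_le hMN ?_) (sup_le ?_ ?_)
    · rintro _ ⟨m, hm, rfl⟩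
      obtain ⟨a, ha, b, hb, rfl⟩ := Submodule.mem_sup.mp (hMN hm)
      rw [LinearMap.mulLeft_apply, mul_add, mem_peirceU.mp ha, mem_peirceV.mp hb, add_zero]
      exact hUN (Submodule.smul_mem _ _ ha)
    · exact hfix.ge.trans (sup_le_sup_right (mulSub_mono le_rfl le_sup_left) _)
    · rw [Submodule.map_le_iff_le_comap]
      refine hfix.ge.trans (sup_le (mulSub_le.mpr fun n hn m hm => ?_) fun l hl => ?_)
      · obtain ⟨u, hu, v, hv, rfl⟩ := Submodule.mem_sup.mp hn
        have hem : e * m ∈ M.map (LinearMap.mulLeft K e) := ⟨m, hm, rfl⟩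
        obtain ⟨a, ha, b, hb, rfl⟩ := Submodule.mem_sup.mp (hMN hm)
        rw [mul_add, mem_peirceU.mp ha, mem_peirceV.mp hb, add_zero,
          Submodule.smul_mem_iff _ (inv_ne_zero h2)] at hem
        have ha' : a ∈ M ⊔ M.map (LinearMap.mulLeft K e) := Submodule.mem_sup_right hem
        have hb' : b ∈ M ⊔ M.map (LinearMap.mulLeft K e) := by
          simpa using sub_mem (Submodule.mem_sup_left hm) ha'
        rw [Submodule.mem_comap, LinearMap.mulLeft_apply, add_mul, mul_add, mul_add, mul_add,
          mul_add, mul_add, mem_peirceV.mp (h.mul_mem_UU u hu a ha),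
          mem_peirceU.mp (h.mul_mem_UV u hu b hb), mem_peirceU.mp (h.mul_mem_VU hv ha),
          mem_peirceU.mp (h.mul_mem_VV v hv b hb), zero_add]
        exact Submodule.mem_sup_left
          (add_mem (Submodule.smul_mem _ _ (mul_mem_mulSub (hUN hu) hb'))
            (add_mem (Submodule.smul_mem _ _ (mul_mem_mulSub (hVN hv) ha'))
              (Submodule.smul_mem _ _ (mul_mem_mulSub (hVN hv) hb'))))
      · rw [Submodule.mem_comap, LinearMap.mulLeft_apply, mem_peirceU.mp hl.1]
        exact Submodule.mem_sup_right (Submodule.smul_mem _ _ hl)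
  have hgr : ∀ a ∈ peirceU K e, ∀ b ∈ peirceV K e, a + b ∈ M → a ∈ M := by
    intro a ha b hb hab
    have hem : e * (a + b) ∈ M := heM (Submodule.mem_sup_right ⟨a + b, hab, rfl⟩)
    rwa [mul_add, mem_peirceU.mp ha, mem_peirceV.mp hb, add_zero,
      Submodule.smul_mem_iff _ (inv_ne_zero h2)] at hem
  refine hXM.trans (h.le_annU_of_le_mulSub_mulSub h2 hMN hNM hgr
    (h.le_mulSub_of_le_mulSub_sup_span h2 hMN hNM s ?_ le_rfl ?_ ?_))
  · exact mulSub_le.mpr fun n hn m hm => h.mul_mem_N hn hm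
  · exact le_sup_right.trans hs.ge
  · rw [← hs]
    exact hfix.ge

end PeirceRelations

end BernsteinAlg

/-! ### The theorem -/

open BernsteinAlg in
theorem lemma5p1 {K A : Type*} [Field K] [Infinite K] (h2 : (2 : K) ≠ 0) (h3 : (3 : K) ≠ 0)
    [NonUnitalNonAssocCommRing A] [Module K A] [SMulCommClass K A A] [IsScalarTower K A A]
    (ω : A →ₙₐ[K] K) (hA : BernsteinAlg.IsBernstein ω)
    (hchain : BernsteinAlg.IsNoetherianAlg K A ∨ BernsteinAlg.IsArtinianAlg K A)
    (e : A) (he : e * e = e) (he0 : e ≠ 0) (I : Submodule K A) :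
    (BernsteinAlg.mulSub (BernsteinAlg.barideal ω) I = I →
      I ≤ BernsteinAlg.annU K e ∧ BernsteinAlg.IsIdeal I) ∧
    (BernsteinAlg.mulSub (BernsteinAlg.barideal ω) I = I ↔
      BernsteinAlg.mulSub (BernsteinAlg.peirceV K e) I = I) := by
  have hω := hA.map_idempotent he he0
  have h := hA.peirceRelations h2 he hω
  have hN := hA.barideal_eq h2 h3 he hω
  have hVN : peirceV K e ≤ barideal ω := hN ▸ le_sup_right
  obtain ⟨s, hs⟩ := h.exists_barideal_eq_sup_span hω hN hchain
  -- Only `I ⊆ N I` is needed, so this also applies when `V I = I`.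
  have key : I ≤ mulSub (barideal ω) I → I ≤ annU K e := by
    intro hI
    have hIN : I ≤ barideal ω := hI.trans (mulSub_le_barideal I)
    rw [hN] at hs hIN hI
    exact h.le_annU_of_le_mulSub h2 hs hIN (hI.trans le_sup_left)
  have hNV : I ≤ annU K e → mulSub (barideal ω) I = mulSub (peirceV K e) I := by
    intro hI
    refine le_antisymm (mulSub_le.mpr fun n hn x hx => ?_) (mulSub_mono hVN le_rfl)
    rw [hN] at hn
    obtain ⟨u, hu, v, hv, rfl⟩ := Submodule.mem_sup.mp hn
    rw [add_mul, mul_comm u, (hI hx).2 u hu, zero_add]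
    exact mul_mem_mulSub hv hx
  refine ⟨fun hI => ⟨key hI.ge, fun a x hx => ?_⟩, fun hI => ?_, fun hI => ?_⟩
  · have hn : a - ω a • e ∈ barideal ω := by
      rw [mem_barideal, map_sub, map_smul, hω, smul_eq_mul, mul_one, sub_self]
    have hex : e * x ∈ I := by
      rw [mem_peirceU.mp (key hI.ge hx).1]
      exact I.smul_mem _ hx
    have := add_mem (hI.le (mul_mem_mulSub hn hx)) (I.smul_mem (ω a) hex)
    rwa [sub_mul, smul_mul_assoc, sub_add_cancel] at this
  · rw [← hNV (key hI.ge), hI]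
  · rw [hNV (key (hI.ge.trans (mulSub_mono hVN le_rfl))), hI]
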